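/- A $k$-out-of-$n$ quantum random access code with storage $m$ consists of an $m$-qubit (possibly mixed) state $\rho_x$ for every $x\in\{0,1\}^n$ and, for every subset $T\subseteq\{1,\dots,n\}$ of size $k$, a POVM $\{E^T_y\}_{y\in\{0,1\}^T}$ on $m$ qubits. Its success probability is $$p=\frac{1}{2^n\binom nk}\sum_{x\in\{0,1\}^n}\ \sum_{|T|=k}\operatorname{tr}\bigl(E^T_{x_T}\rho_x\bigr),$$ the probability of guessing the substring $x_T$ correctly for uniformly random $x$ and an independent uniformly random $k$-subset $T$. For every constant $\varepsilon>0$ there are $c>0$ and $k_0$, depending only on $\varepsilon$, such that for all integers $n\ge k\ge k_0$ and $m\ge 0$ with $m\le(1-\varepsilon)n$, every $k$-out-of-$n$ quantum random access code with storage $m$ has success probability at most $2^{-ck}$; that is, the success probability is at most $2^{-\Omega(k)}$. The threshold for the storage rate $m/n$ is optimal: for all $k\le n$ there is a $k$-out-of-$n$ quantum random access code with storage $m=n$ and success probability $1$. -/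

import Mathlib

open scoped ComplexOrder

/-- A (possibly mixed) state of `m` qubits: a positive semidefinite matrix of trace one on
`ℂ^(2^m)`, whose standard basis is indexed by the bit strings of length `m`. -/
structure QubitState (m : ℕ) where
  mat : Matrix (Fin m → Bool) (Fin m → Bool) ℂ
  posSemidef : mat.PosSemidef
  trace_eq_one : mat.trace = 1

/-- A POVM on `m` qubits with outcomes in the finite type `α`. -/
structure QubitPOVM (m : ℕ) (α : Type) [Fintype α] where
  effect : α → Matrix (Fin m → Bool) (Fin m → Bool) ℂ
  posSemidef : ∀ a, (effect a).PosSemidef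
  sum_eq_one : ∑ a, effect a = 1

/-- The probability that measuring the state `ρ` with the POVM `E` gives the outcome `a`. -/
noncomputable def QubitPOVM.prob {m : ℕ} {α : Type} [Fintype α] (E : QubitPOVM m α)
    (ρ : QubitState m) (a : α) : ℝ :=
  ((E.effect a * ρ.mat).trace).re

/-- The subsets of size `k` of the set of `n` positions. -/
abbrev KSubset (n k : ℕ) : Type := {T : Finset (Fin n) // T.card = k}

/-- The substring `x_T` of the bit string `x` at the positions in `T`. -/
def substring {n : ℕ} (x : Fin n → Bool) (T : Finset (Fin n)) : T → Bool := fun i => x i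

/-- A `k`-out-of-`n` quantum random access code with `m` qubits of storage: every string of `n`
bits is encoded into a state of `m` qubits, and for every set `T` of `k` positions there is a
measurement of the `m` qubits whose outcome is the guess for the substring at `T`. -/
structure QRAC (n m k : ℕ) where
  encode : (Fin n → Bool) → QubitState m
  decode : (T : KSubset n k) → QubitPOVM m (T.1 → Bool)

/-- The success probability: the probability that the decoder guesses `x_T` correctly, for `x`
uniform on the strings of `n` bits and `T` uniform, independently of `x`, on the subsets of
size `k`. -/
noncomputable def QRAC.successProb {n m k : ℕ} (R : QRAC n m k) : ℝ :=
  (∑ x : Fin n → Bool, ∑ T : KSubset n k,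
    (R.decode T).prob (R.encode x) (substring x T.1)) / ((2 : ℝ) ^ n * (n.choose k : ℝ))

/-! Let `M x` be the sum over `T` of the effects of the correct outcomes. Jensen's inequality bounds
the `2r`-th power of the success probability by moments `tr (M x ^ (2r) ρ_x)`, and
`sum_pow_le_sum_nestedProd` bounds these by averages over `r`-tuples of `k`-subsets of the
probability that measuring in succession gives only correct outcomes.

If a tuple covers `u` positions, a successful run determines `u` bits of `x`, so summing over `x`
gives at most `2 ^ (n - u) * 2 ^ m` (`sum_trace_nestedProd_le`). Few tuples cover at most `v`
positions (`card_filter_cover_le`). With `v` between `m` and `n` and `r` of order `n / k`, the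
moment is `2 ^ (-Ω(n))`, and its `2r`-th root is `2 ^ (-Ω(k))`. -/

open scoped MatrixOrder

/-! ### Inequalities in the Loewner order. -/

namespace Matrix

variable {ι κ : Type*} [Fintype ι] [DecidableEq ι]

theorem trace_mul_re_nonneg {A B : Matrix ι ι ℂ} (hA : 0 ≤ A) (hB : 0 ≤ B) :
    0 ≤ (A * B).trace.re := by
  obtain ⟨X, rfl⟩ := CStarAlgebra.nonneg_iff_eq_star_mul_self.mp hA
  rw [mul_assoc, trace_mul_comm]
  have h := ((nonneg_iff_posSemidef.mp hB).mul_mul_conjTranspose_same X).trace_nonneg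
  exact (Complex.le_def.mp h).1

theorem trace_mul_re_mono {A B C : Matrix ι ι ℂ} (hAB : A ≤ B) (hC : 0 ≤ C) :
    (A * C).trace.re ≤ (B * C).trace.re := by
  have h := trace_mul_re_nonneg (sub_nonneg.mpr hAB) hC
  rw [sub_mul, trace_sub, Complex.sub_re] at h
  linarith

theorem mul_self_le_self {A : Matrix ι ι ℂ} (h0 : 0 ≤ A) (h1 : A ≤ 1) : A * A ≤ A := by
  have h0' : 0 ≤ 1 - A := sub_nonneg.mpr h1
  have e1 := conjugate_nonneg_of_nonneg h0' h0
  have e2 := conjugate_nonneg_of_nonneg h0 h0'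
  rw [← sub_nonneg]
  -- `A - A² = A(1 - A)A + (1 - A)A(1 - A)`.
  convert add_nonneg e1 e2 using 1
  noncomm_ring

/-- An operator Cauchy–Schwarz inequality: the variance of `E t` about its mean, weighted by `A`, is
nonnegative. -/
theorem conjugate_sum_le_card_smul [Fintype κ] (E : κ → Matrix ι ι ℂ) (hE : ∀ t, 0 ≤ E t)
    {A : Matrix ι ι ℂ} (hA : 0 ≤ A) :
    (∑ t, E t) * A * (∑ t, E t) ≤ (Fintype.card κ : ℝ) • ∑ t, E t * A * E t := by
  rcases isEmpty_or_nonempty κ with h | h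
  · simp
  have hN : (0 : ℝ) < Fintype.card κ := by exact_mod_cast Fintype.card_pos
  set N : ℝ := (Fintype.card κ : ℝ) with hNdef
  set M := ∑ t, E t with hM
  have hM0 : 0 ≤ M := Finset.sum_nonneg fun t _ => hE t
  have key : 0 ≤ ∑ t, (E t - N⁻¹ • M) * A * (E t - N⁻¹ • M) := by
    refine Finset.sum_nonneg fun t _ => ?_
    have hs : IsSelfAdjoint (E t - N⁻¹ • M) :=
      (IsSelfAdjoint.of_nonneg (hE t)).sub ((IsSelfAdjoint.all N⁻¹).smul
        (IsSelfAdjoint.of_nonneg hM0))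
    exact hs.conjugate_nonneg hA
  have expand : ∑ t, (E t - N⁻¹ • M) * A * (E t - N⁻¹ • M)
      = (∑ t, E t * A * E t) - N⁻¹ • (M * A * M) := by
    simp only [sub_mul, mul_sub, Finset.sum_sub_distrib, smul_mul_assoc, mul_smul_comm,
      ← Finset.smul_sum, ← Finset.sum_mul, ← Finset.mul_sum, ← hM]
    rw [Finset.sum_const, Finset.card_univ, ← Nat.cast_smul_eq_nsmul ℝ, ← hNdef, smul_mul_assoc,
      smul_mul_assoc, smul_smul, inv_mul_cancel₀ hN.ne', one_smul, sub_self, smul_zero, sub_zero]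
  rw [expand, sub_nonneg] at key
  have := smul_le_smul_of_nonneg_left key hN.le
  rwa [smul_smul, mul_inv_cancel₀ hN.ne', one_smul] at this

/-- The product `E (t 0) * ⋯ * E (t (r - 1)) * E (t (r - 1)) * ⋯ * E (t 0)`. -/
def nestedProd (E : κ → Matrix ι ι ℂ) : {r : ℕ} → (Fin r → κ) → Matrix ι ι ℂ
  | 0, _ => 1
  | _ + 1, t => E (t 0) * nestedProd E (Fin.tail t) * E (t 0)

theorem nestedProd_nonneg (E : κ → Matrix ι ι ℂ) (hE : ∀ t, 0 ≤ E t) {r : ℕ} (t : Fin r → κ) :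
    0 ≤ nestedProd E t := by
  induction r with
  | zero => exact zero_le_one
  | succ r ih => exact conjugate_nonneg_of_nonneg (ih _) (hE _)

theorem nestedProd_le_one (E : κ → Matrix ι ι ℂ) (hE : ∀ t, 0 ≤ E t) (hE1 : ∀ t, E t ≤ 1)
    {r : ℕ} (t : Fin r → κ) : nestedProd E t ≤ 1 := by
  induction r with
  | zero => exact le_rfl
  | succ r ih =>
    calc E (t 0) * nestedProd E (Fin.tail t) * E (t 0) ≤ E (t 0) * 1 * E (t 0) :=
          conjugate_le_conjugate_of_nonneg (ih _) (hE _)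
      _ = E (t 0) * E (t 0) := by rw [mul_one]
      _ ≤ E (t 0) := mul_self_le_self (hE _) (hE1 _)
      _ ≤ 1 := hE1 _

theorem sum_pow_le_sum_nestedProd [Fintype κ] (E : κ → Matrix ι ι ℂ) (hE : ∀ t, 0 ≤ E t) (r : ℕ) :
    (∑ t, E t) ^ (2 * r) ≤ (Fintype.card κ : ℝ) ^ r • ∑ t : Fin r → κ, nestedProd E t := by
  induction r with
  | zero => simp [nestedProd]
  | succ r ih =>
    have hM0 : 0 ≤ ∑ t, E t := Finset.sum_nonneg fun t _ => hE t
    have hS0 : 0 ≤ ∑ t : Fin r → κ, nestedProd E t :=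
      Finset.sum_nonneg fun t _ => nestedProd_nonneg E hE t
    have hN : (0 : ℝ) ≤ (Fintype.card κ : ℝ) ^ r := by positivity
    calc (∑ t, E t) ^ (2 * (r + 1)) = (∑ t, E t) * (∑ t, E t) ^ (2 * r) * (∑ t, E t) := by
          rw [← pow_succ', ← pow_succ]; congr 1
      _ ≤ (∑ t, E t) * ((Fintype.card κ : ℝ) ^ r • ∑ t : Fin r → κ, nestedProd E t) *
            (∑ t, E t) := conjugate_le_conjugate_of_nonneg ih hM0
      _ = (Fintype.card κ : ℝ) ^ r •
            ((∑ t, E t) * (∑ t : Fin r → κ, nestedProd E t) * (∑ t, E t)) := by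
          rw [mul_smul_comm, smul_mul_assoc]
      _ ≤ (Fintype.card κ : ℝ) ^ r • ((Fintype.card κ : ℝ) •
            ∑ s, E s * (∑ t : Fin r → κ, nestedProd E t) * E s) :=
          smul_le_smul_of_nonneg_left (conjugate_sum_le_card_smul E hE hS0) hN
      _ = _ := by
          rw [smul_smul, ← pow_succ, ← (Fin.consEquiv fun _ => κ).sum_comp, Fintype.sum_prod_type]
          simp only [Finset.mul_sum, Finset.sum_mul]
          rfl

/-- In an eigenbasis of `A` the diagonal of `ρ` is a probability distribution on the eigenvalues,
and even powers are convex. -/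
theorem trace_mul_pow_le {A ρ : Matrix ι ι ℂ} (hA : A.IsHermitian) (hρ : ρ.PosSemidef)
    (hρ1 : ρ.trace = 1) (r : ℕ) :
    (A * ρ).trace.re ^ (2 * r) ≤ (A ^ (2 * r) * ρ).trace.re := by
  set U := hA.eigenvectorUnitary
  set σ : Matrix ι ι ℂ := (U : Matrix ι ι ℂ)ᴴ * ρ * U with hσ
  have hσ0 : σ.PosSemidef := hρ.conjTranspose_mul_mul_same _
  have hpow : ∀ j : ℕ, (A ^ j * ρ).trace.re = ∑ i, (σ i i).re * hA.eigenvalues i ^ j := by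
    intro j
    have h1 : A ^ j = U * diagonal (fun i => (hA.eigenvalues i : ℂ) ^ j) *
        (U : Matrix ι ι ℂ)ᴴ := by
      conv_lhs => rw [hA.spectral_theorem]
      rw [← map_pow, diagonal_pow]
      rfl
    rw [h1, trace_mul_comm, ← mul_assoc, trace_mul_comm, ← mul_assoc, ← mul_assoc, ← hσ]
    simp only [trace, diag_apply, mul_diagonal, Complex.re_sum]
    refine Finset.sum_congr rfl fun i _ => ?_
    rw [← Complex.ofReal_pow, Complex.re_mul_ofReal]
  have h0 := hpow 0
  have h1 := hpow 1
  simp only [pow_zero, one_mul, mul_one, hρ1, Complex.one_re, pow_one] at h0 h1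
  rw [hpow, h1]
  exact Real.pow_arith_mean_le_arith_mean_pow_of_even _ _ _
    (fun i _ => (Complex.le_def.mp hσ0.diag_nonneg).1) h0.symm (even_two_mul r)

theorem PosSemidef.le_one_of_trace_eq_one {ρ : Matrix ι ι ℂ} (hρ : ρ.PosSemidef)
    (hρ1 : ρ.trace = 1) : ρ ≤ 1 := by
  have hH := hρ.isHermitian
  set U := hH.eigenvectorUnitary
  have hUU : (U : Matrix ι ι ℂ) * (U : Matrix ι ι ℂ)ᴴ = 1 := Unitary.mul_star_self_of_mem U.2
  have hsum : ∑ i, hH.eigenvalues i = 1 := by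
    have h := hH.trace_eq_sum_eigenvalues
    rw [hρ1] at h
    simpa using congrArg Complex.re h.symm
  have hle : ∀ i, hH.eigenvalues i ≤ 1 := fun i => hsum ▸
    Finset.single_le_sum (fun j _ => hρ.eigenvalues_nonneg j) (Finset.mem_univ i)
  have h1 : ρ = U * diagonal (fun i => (hH.eigenvalues i : ℂ)) * (U : Matrix ι ι ℂ)ᴴ :=
    hH.spectral_theorem
  have h2 : (1 : Matrix ι ι ℂ) - ρ
      = U * diagonal (fun i => 1 - (hH.eigenvalues i : ℂ)) * (U : Matrix ι ι ℂ)ᴴ := by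
    rw [← diagonal_sub, mul_sub, sub_mul, ← h1, diagonal_one, mul_one, hUU]
  rw [le_iff, h2]
  refine PosSemidef.mul_mul_conjTranspose_same (PosSemidef.diagonal fun i => ?_) _
  have := hle i
  simp only [Pi.zero_apply, sub_nonneg]
  exact_mod_cast this

end Matrix

/-! ### Counting tuples of `k`-subsets with small cover. -/

theorem Nat.choose_mul_pow_le {v n : ℕ} (k : ℕ) (hv : v ≤ n) :
    v.choose k * n ^ k ≤ n.choose k * v ^ k := by
  have h : v.descFactorial k * n ^ k ≤ n.descFactorial k * v ^ k := by
    induction k with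
    | zero => simp
    | succ k ih =>
      have h1 : (v - k) * n ≤ (n - k) * v := by
        rw [Nat.sub_mul, Nat.sub_mul, mul_comm v n]
        exact Nat.sub_le_sub_left (Nat.mul_le_mul_left k hv) _
      calc v.descFactorial (k + 1) * n ^ (k + 1)
          = ((v - k) * n) * (v.descFactorial k * n ^ k) := by rw [Nat.descFactorial_succ]; ring
        _ ≤ ((n - k) * v) * (n.descFactorial k * v ^ k) := Nat.mul_le_mul h1 ih
        _ = n.descFactorial (k + 1) * v ^ (k + 1) := by rw [Nat.descFactorial_succ]; ring
  rw [Nat.descFactorial_eq_factorial_mul_choose, Nat.descFactorial_eq_factorial_mul_choose,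
    mul_assoc, mul_assoc] at h
  exact Nat.le_of_mul_le_mul_left h k.factorial_pos

namespace KSubset

variable {n k r : ℕ}

theorem card_eq : Fintype.card (KSubset n k) = n.choose k := by
  simp [KSubset, Fintype.card_finset_len]

/-- The set of all positions covered by a tuple of `k`-subsets. -/
def cover (t : Fin r → KSubset n k) : Finset (Fin n) :=
  Finset.univ.biUnion fun i => (t i).1

theorem card_filter_subset (V : Finset (Fin n)) :
    (Finset.univ.filter fun T : KSubset n k => T.1 ⊆ V).card = V.card.choose k := by
  rw [← Finset.card_powersetCard, ← Finset.card_map (Function.Embedding.subtype _)]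
  congr 1
  ext T
  simp only [Finset.mem_map, Finset.mem_filter, Finset.mem_univ, true_and,
    Function.Embedding.subtype_apply, Finset.mem_powersetCard]
  exact ⟨fun ⟨S, hS, hT⟩ => hT ▸ ⟨hS, S.2⟩, fun ⟨h, hT⟩ => ⟨⟨T, hT⟩, h, rfl⟩⟩

/-- A union bound over the at most `2 ^ n` possible covers `V`: each of the `r` subsets lies in `V`
for at most a fraction `(v / n) ^ k` of the choices. -/
theorem card_filter_cover_le (hn : 0 < n) {v : ℝ} (hv : 0 ≤ v) :
    ((Finset.univ.filter fun t : Fin r → KSubset n k => ((cover t).card : ℝ) ≤ v).card : ℝ) ≤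
      2 ^ n * ((n.choose k : ℝ) * (v / n) ^ k) ^ r := by
  classical
  have hsub : (Finset.univ.filter fun t : Fin r → KSubset n k => ((cover t).card : ℝ) ≤ v) ⊆
      (Finset.univ.filter fun V : Finset (Fin n) => (V.card : ℝ) ≤ v).biUnion fun V =>
        Fintype.piFinset fun _ : Fin r =>
          Finset.univ.filter fun T : KSubset n k => T.1 ⊆ V := by
    intro t ht
    simp only [Finset.mem_filter, Finset.mem_univ, true_and] at ht
    simp only [Finset.mem_biUnion, Finset.mem_filter, Finset.mem_univ, true_and,
      Fintype.mem_piFinset]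
    exact ⟨cover t, ht, fun i => Finset.subset_biUnion_of_mem (fun i => (t i).1)
      (Finset.mem_univ i)⟩
  have hn' : (0 : ℝ) < n := by exact_mod_cast hn
  have hone : ∀ V : Finset (Fin n), (V.card : ℝ) ≤ v →
      (V.card.choose k : ℝ) ≤ (n.choose k : ℝ) * (v / n) ^ k := by
    intro V hV
    have hVn : V.card ≤ n := by simpa using V.card_le_univ
    have h : (V.card.choose k : ℝ) * (n : ℝ) ^ k ≤ n.choose k * (V.card : ℝ) ^ k := by
      exact_mod_cast Nat.choose_mul_pow_le k hVn
    rw [div_pow, mul_div_assoc', le_div_iff₀ (by positivity)]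
    exact h.trans (by gcongr)
  calc ((Finset.univ.filter fun t : Fin r → KSubset n k => ((cover t).card : ℝ) ≤ v).card : ℝ)
      ≤ ∑ V ∈ Finset.univ.filter fun V : Finset (Fin n) => (V.card : ℝ) ≤ v,
          ((V.card.choose k : ℝ)) ^ r := by
        have h := (Finset.card_le_card hsub).trans Finset.card_biUnion_le
        simp only [Fintype.card_piFinset, Finset.prod_const, Finset.card_univ, Fintype.card_fin,
          card_filter_subset] at h
        exact_mod_cast h
    _ ≤ ∑ V ∈ Finset.univ.filter fun V : Finset (Fin n) => (V.card : ℝ) ≤ v,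
          ((n.choose k : ℝ) * (v / n) ^ k) ^ r :=
        Finset.sum_le_sum fun V hV =>
          pow_le_pow_left₀ (by positivity) (hone V (Finset.mem_filter.mp hV).2) r
    _ ≤ ∑ V : Finset (Fin n), ((n.choose k : ℝ) * (v / n) ^ k) ^ r :=
        Finset.sum_le_sum_of_subset_of_nonneg (Finset.filter_subset _ _)
          fun _ _ _ => by positivity
    _ = _ := by simp

end KSubset

/-! ### Moment bound for the success probability. -/

namespace QRAC

open Matrix

variable {n m k : ℕ}

theorem effect_le_one {α : Type} [Fintype α] (E : QubitPOVM m α) (a : α) : E.effect a ≤ 1 := by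
  rw [← E.sum_eq_one]
  exact Finset.single_le_sum (fun b _ => (E.posSemidef b).nonneg) (Finset.mem_univ a)

/-- The effect at `T` of the correct outcome for the string `x`. -/
def correctEffect (R : QRAC n m k) (x : Fin n → Bool) (T : KSubset n k) :
    Matrix (Fin m → Bool) (Fin m → Bool) ℂ :=
  (R.decode T).effect (substring x T.1)

theorem correctEffect_nonneg (R : QRAC n m k) (x : Fin n → Bool) (T : KSubset n k) :
    0 ≤ R.correctEffect x T :=
  ((R.decode T).posSemidef _).nonneg

theorem correctEffect_le_one (R : QRAC n m k) (x : Fin n → Bool) (T : KSubset n k) :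
    R.correctEffect x T ≤ 1 :=
  effect_le_one _ _

/-- The outcomes of the successive measurements identify `x` within `X`, so these are effects of
distinct outcomes of one sequential measurement. In the induction, strings with the same first
outcome agree on `t 0`, hence are separated by the cover of the tail. -/
theorem sum_nestedProd_le_one (R : QRAC n m k) {r : ℕ} (t : Fin r → KSubset n k)
    (X : Finset (Fin n → Bool))
    (hX : ∀ x ∈ X, ∀ y ∈ X, (∀ i ∈ KSubset.cover t, x i = y i) → x = y) :
    ∑ x ∈ X, nestedProd (R.correctEffect x) t ≤ 1 := by
  classical
  induction r generalizing X with
  | zero =>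
    -- The empty tuple covers nothing, so `hX` identifies all elements of `X`.
    have hcard : X.card ≤ 1 := Finset.card_le_one.mpr fun x hx y hy =>
      hX x hx y hy fun i hi => by simp [KSubset.cover] at hi
    rcases Finset.card_le_one_iff_subset_singleton.mp hcard with ⟨x, hx⟩
    calc ∑ x ∈ X, nestedProd (R.correctEffect x) t
        ≤ ∑ x ∈ {x}, nestedProd (R.correctEffect x) t :=
          Finset.sum_le_sum_of_subset_of_nonneg hx
            fun x _ _ => nestedProd_nonneg _ (R.correctEffect_nonneg x) t
      _ = 1 := by simp [nestedProd]
  | succ r ih =>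
    set D := R.decode (t 0)
    calc ∑ x ∈ X, nestedProd (R.correctEffect x) t
        = ∑ y, D.effect y * (∑ x ∈ X with substring x (t 0).1 = y,
            nestedProd (R.correctEffect x) (Fin.tail t)) * D.effect y := by
          rw [← Finset.sum_fiberwise X fun x => substring x (t 0).1]
          refine Finset.sum_congr rfl fun y _ => ?_
          rw [Finset.mul_sum, Finset.sum_mul]
          refine Finset.sum_congr rfl fun x hx => ?_
          rw [← (Finset.mem_filter.mp hx).2]
          rfl
      _ ≤ ∑ y, D.effect y * 1 * D.effect y := by
          refine Finset.sum_le_sum fun y _ =>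
            conjugate_le_conjugate_of_nonneg (ih (Fin.tail t) _ ?_) (D.posSemidef y).nonneg
          intro x hx x' hx' h
          rw [Finset.mem_filter] at hx hx'
          refine hX x hx.1 x' hx'.1 fun i hi => ?_
          by_cases hi0 : i ∈ (t 0).1
          · exact congrFun (hx.2.trans hx'.2.symm) ⟨i, hi0⟩
          · refine h i ?_
            simp only [KSubset.cover, Finset.mem_biUnion, Finset.mem_univ, true_and] at hi ⊢
            obtain ⟨j, hj⟩ := hi
            induction j using Fin.cases with
            | zero => exact absurd hj hi0
            | succ j => exact ⟨j, hj⟩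
      _ ≤ ∑ y, D.effect y := by
          refine Finset.sum_le_sum fun y _ => ?_
          rw [mul_one]
          exact mul_self_le_self (D.posSemidef y).nonneg (effect_le_one D y)
      _ = 1 := D.sum_eq_one

/-- Once the bits outside the cover are fixed, the cover separates the remaining strings. -/
theorem sum_univ_nestedProd_le (R : QRAC n m k) {r : ℕ} (t : Fin r → KSubset n k) :
    ∑ x, nestedProd (R.correctEffect x) t ≤
      ((2 : ℝ) ^ (n - (KSubset.cover t).card)) • (1 : Matrix (Fin m → Bool) (Fin m → Bool) ℂ) := by
  classical
  set U := KSubset.cover t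
  rw [← Finset.sum_fiberwise Finset.univ fun x : Fin n → Bool => substring x Uᶜ]
  calc _ ≤ ∑ _y : (Uᶜ : Finset (Fin n)) → Bool, (1 : Matrix (Fin m → Bool) (Fin m → Bool) ℂ) := by
        refine Finset.sum_le_sum fun y _ => R.sum_nestedProd_le_one t _ ?_
        intro x hx x' hx' h
        rw [Finset.mem_filter] at hx hx'
        funext i
        by_cases hi : i ∈ U
        · exact h i hi
        · exact congrFun (hx.2.trans hx'.2.symm) ⟨i, Finset.mem_compl.mpr hi⟩
    _ = _ := by
        rw [Finset.sum_const, Finset.card_univ, ← Nat.cast_smul_eq_nsmul ℝ, Fintype.card_fun,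
          Fintype.card_coe, Finset.card_compl]
        simp

/-- Replacing every state by the identity removes the dependence on the encoding, at the price of
the trace `2 ^ m`. -/
theorem sum_trace_nestedProd_le (R : QRAC n m k) {r : ℕ} (t : Fin r → KSubset n k) :
    ∑ x, (nestedProd (R.correctEffect x) t * (R.encode x).mat).trace.re ≤
      2 ^ (n - (KSubset.cover t).card) * 2 ^ m := by
  calc ∑ x, (nestedProd (R.correctEffect x) t * (R.encode x).mat).trace.re
      ≤ ∑ x, (nestedProd (R.correctEffect x) t * 1).trace.re := by
        refine Finset.sum_le_sum fun x _ => ?_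
        rw [trace_mul_comm, trace_mul_comm _ 1]
        exact trace_mul_re_mono
          ((R.encode x).posSemidef.le_one_of_trace_eq_one (R.encode x).trace_eq_one)
          (nestedProd_nonneg _ (R.correctEffect_nonneg x) t)
    _ = ((∑ x, nestedProd (R.correctEffect x) t) * 1).trace.re := by
        rw [Finset.sum_mul, trace_sum, Complex.re_sum]
    _ ≤ (((2 : ℝ) ^ (n - (KSubset.cover t).card)) •
          (1 : Matrix (Fin m → Bool) (Fin m → Bool) ℂ) * 1).trace.re :=
        trace_mul_re_mono (R.sum_univ_nestedProd_le t) zero_le_one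
    _ = 2 ^ (n - (KSubset.cover t).card) * 2 ^ m := by
        rw [mul_one, trace_smul, trace_one, Complex.smul_re, Complex.natCast_re, smul_eq_mul]
        simp

theorem sum_trace_nestedProd_le_two_pow (R : QRAC n m k) {r : ℕ} (t : Fin r → KSubset n k) :
    ∑ x, (nestedProd (R.correctEffect x) t * (R.encode x).mat).trace.re ≤ 2 ^ n := by
  have h : ∀ x, (nestedProd (R.correctEffect x) t * (R.encode x).mat).trace.re ≤ 1 := fun x => by
    have h1 := trace_mul_re_mono
      (nestedProd_le_one _ (R.correctEffect_nonneg x) (R.correctEffect_le_one x) t)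
      (R.encode x).posSemidef.nonneg
    rwa [one_mul, (R.encode x).trace_eq_one, Complex.one_re] at h1
  exact (Finset.sum_le_sum fun x _ => h x).trans_eq (by simp)

theorem sum_prob_pow_le (R : QRAC n m k) (x : Fin n → Bool) (r : ℕ) :
    (∑ T, (R.decode T).prob (R.encode x) (substring x T.1)) ^ (2 * r) ≤
      (n.choose k : ℝ) ^ r *
        ∑ t : Fin r → KSubset n k,
          (nestedProd (R.correctEffect x) t * (R.encode x).mat).trace.re := by
  have hρ := (R.encode x).posSemidef
  have hM : 0 ≤ ∑ T, R.correctEffect x T :=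
    Finset.sum_nonneg fun T _ => R.correctEffect_nonneg x T
  have h0 : ∑ T, (R.decode T).prob (R.encode x) (substring x T.1) =
      ((∑ T, R.correctEffect x T) * (R.encode x).mat).trace.re := by
    rw [Finset.sum_mul, trace_sum, Complex.re_sum]
    rfl
  have h1 := trace_mul_pow_le (nonneg_iff_posSemidef.mp hM).isHermitian hρ
    (R.encode x).trace_eq_one r
  have h2 := trace_mul_re_mono (sum_pow_le_sum_nestedProd _ (R.correctEffect_nonneg x) r) hρ.nonneg
  rw [h0]
  refine (h1.trans h2).trans_eq ?_
  rw [smul_mul_assoc, trace_smul, Complex.smul_re, Finset.sum_mul, trace_sum, Complex.re_sum,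
    KSubset.card_eq, smul_eq_mul]

theorem successProb_pow_le (R : QRAC n m k) (hn : 0 < n) (hk : k ≤ n) {v : ℝ} (hv : 0 ≤ v)
    (r : ℕ) :
    R.successProb ^ (2 * r) ≤ 2 ^ n * (v / n) ^ (k * r) + (2 : ℝ) ^ ((m : ℝ) - v) := by
  classical
  set N : ℝ := (n.choose k : ℝ) with hNdef
  have hN : 0 < N := Nat.cast_pos.mpr (Nat.choose_pos hk)
  set a : (Fin n → Bool) → ℝ := fun x =>
    ∑ T, (R.decode T).prob (R.encode x) (substring x T.1)
  set g : (Fin n → Bool) → (Fin r → KSubset n k) → ℝ := fun x t =>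
    (nestedProd (R.correctEffect x) t * (R.encode x).mat).trace.re
  have hP : R.successProb = (∑ x, ((2 : ℝ) ^ n)⁻¹ * a x) / N := by
    rw [← Finset.mul_sum, successProb, ← hNdef]
    field_simp
    rfl
  have hJ : (∑ x, ((2 : ℝ) ^ n)⁻¹ * a x) ^ (2 * r) ≤ ∑ x, ((2 : ℝ) ^ n)⁻¹ * a x ^ (2 * r) :=
    Real.pow_arith_mean_le_arith_mean_pow_of_even _ _ _ (fun _ _ => by positivity)
      (by simp) (even_two_mul r)
  -- Tuples with small cover get the trivial bound; the storage bound handles the rest.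
  have hcover : ∀ t : Fin r → KSubset n k, ∑ x, g x t ≤
      (if ((KSubset.cover t).card : ℝ) ≤ v then 2 ^ n else 0) +
        2 ^ n * (2 : ℝ) ^ ((m : ℝ) - v) := by
    intro t
    split_ifs with h
    · exact (R.sum_trace_nestedProd_le_two_pow t).trans (le_add_of_nonneg_right (by positivity))
    · rw [zero_add]
      refine (R.sum_trace_nestedProd_le t).trans ?_
      have hc : (KSubset.cover t).card ≤ n := by simpa using (KSubset.cover t).card_le_univ
      rw [← Real.rpow_natCast 2 (n - _), ← Real.rpow_natCast 2 m, ← Real.rpow_natCast 2 n,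
        ← Real.rpow_add two_pos, ← Real.rpow_add two_pos, Nat.cast_sub hc]
      exact Real.rpow_le_rpow_of_exponent_le one_le_two (by linarith)
  have htotal : ∑ t, ∑ x, g x t ≤
      2 ^ n * (2 ^ n * (N * (v / n) ^ k) ^ r) + N ^ r * (2 ^ n * (2 : ℝ) ^ ((m : ℝ) - v)) := by
    refine (Finset.sum_le_sum fun t _ => hcover t).trans ?_
    rw [Finset.sum_add_distrib, ← Finset.sum_filter, Finset.sum_const, Finset.sum_const,
      Finset.card_univ, Fintype.card_fun, Fintype.card_fin, KSubset.card_eq, nsmul_eq_mul,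
      nsmul_eq_mul, Nat.cast_pow, ← hNdef, mul_comm _ ((2 : ℝ) ^ n)]
    gcongr
    exact KSubset.card_filter_cover_le hn hv
  have hmain : (∑ x, ((2 : ℝ) ^ n)⁻¹ * a x) ^ (2 * r) ≤
      N ^ (2 * r) * (2 ^ n * (v / n) ^ (k * r) + (2 : ℝ) ^ ((m : ℝ) - v)) := by
    calc _ ≤ ∑ x, ((2 : ℝ) ^ n)⁻¹ * a x ^ (2 * r) := hJ
      _ ≤ ∑ x, ((2 : ℝ) ^ n)⁻¹ * (N ^ r * ∑ t, g x t) :=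
          Finset.sum_le_sum fun x _ => by
            gcongr
            exact R.sum_prob_pow_le x r
      _ = ((2 : ℝ) ^ n)⁻¹ * (N ^ r * ∑ t, ∑ x, g x t) := by
          rw [Finset.sum_comm, Finset.mul_sum, Finset.mul_sum]
      _ ≤ ((2 : ℝ) ^ n)⁻¹ * (N ^ r * (2 ^ n * (2 ^ n * (N * (v / n) ^ k) ^ r) +
            N ^ r * (2 ^ n * (2 : ℝ) ^ ((m : ℝ) - v)))) := by gcongr
      _ = _ := by
          rw [mul_pow, ← pow_mul, two_mul r, pow_add]
          field_simp
  rw [hP, div_pow, div_le_iff₀ (by positivity), mul_comm _ (N ^ (2 * r))]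
  exact hmain

end QRAC

/-! ### Optimality of the threshold. -/

open Matrix in
/-- The code that stores the string itself in the standard basis. -/
noncomputable def QRAC.standardBasis (n k : ℕ) : QRAC n n k where
  encode x :=
    { mat := diagonal (Pi.single x 1)
      posSemidef := PosSemidef.diagonal (Pi.single_nonneg.mpr zero_le_one)
      trace_eq_one := by simp [trace_diagonal] }
  decode T :=
    { effect := fun y => diagonal fun x => if substring x T.1 = y then 1 else 0
      posSemidef := fun y => PosSemidef.diagonal fun x => by
        simp only [Pi.zero_apply]
        split_ifs <;> simp
      sum_eq_one := by
        ext x x'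
        rw [Matrix.sum_apply]
        by_cases h : x = x' <;> simp [h, one_apply] }

theorem QRAC.standardBasis_successProb {n k : ℕ} (hk : k ≤ n) :
    (QRAC.standardBasis n k).successProb = 1 := by
  have hprob : ∀ x (T : KSubset n k), ((standardBasis n k).decode T).prob
      ((standardBasis n k).encode x) (substring x T.1) = 1 := by
    intro x T
    simp [QubitPOVM.prob, standardBasis, Matrix.diagonal_mul_diagonal, Matrix.trace_diagonal,
      Pi.single_apply]
  have hN : (0 : ℝ) < n.choose k := Nat.cast_pos.mpr (Nat.choose_pos hk)
  simp only [successProb, hprob, Finset.sum_const, Finset.card_univ, KSubset.card_eq,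
    nsmul_eq_mul, mul_one, Fintype.card_fun, Fintype.card_bool, Fintype.card_fin, Nat.cast_pow,
    Nat.cast_ofNat]
  exact div_self (by positivity)

/-! ### Choice of the parameters. -/

theorem corollary2 :
    (∀ ε : ℝ, 0 < ε → ∃ c : ℝ, 0 < c ∧ ∃ k₀ : ℕ, ∀ n m k : ℕ,
      k₀ ≤ k → k ≤ n → (m : ℝ) ≤ (1 - ε) * (n : ℝ) →
        ∀ R : QRAC n m k, R.successProb ≤ (2 : ℝ) ^ (-(c * (k : ℝ)))) ∧
    (∀ n k : ℕ, k ≤ n → ∃ R : QRAC n n k, R.successProb = 1) := by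
  refine ⟨fun ε hε => ?_, fun n k hk => ⟨_, QRAC.standardBasis_successProb hk⟩⟩
  -- Capping `ε` at 1 keeps the base `1 - e / 2` nonnegative.
  obtain ⟨e, he0, he1, heε⟩ : ∃ e : ℝ, 0 < e ∧ e ≤ 1 ∧ e ≤ ε :=
    ⟨min ε 1, lt_min hε one_pos, min_le_right _ _, min_le_left _ _⟩
  -- With this `C`, the factor `(1 - e / 2) ^ (C * n) ≤ 4 ^ (-n)` beats the `2 ^ n` of the union
  -- bound.
  obtain ⟨C, hC⟩ := exists_pow_lt_of_lt_one (show (0 : ℝ) < 1 / 4 by norm_num)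
    (show 1 - e / 2 < 1 by linarith)
  have hq0 : 0 ≤ 1 - e / 2 := by linarith
  -- `k ≥ 4 / e` gives `e * n ≥ 4`, which absorbs the factor 2 from adding two error terms. The
  -- constant comes from the `2r`-th root of `2 ^ (-(e * n / 4))` with `r * k ≤ (C + 1) * n`.
  refine ⟨e / (8 * (C + 1)), by positivity, ⌈4 / e⌉₊, fun n m k hk0 hkn hm R => ?_⟩
  have hke : 4 / e ≤ k := (Nat.le_ceil _).trans (by exact_mod_cast hk0)
  have hk : 0 < k := by
    have : (0 : ℝ) < k := lt_of_lt_of_le (by positivity) hke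
    exact_mod_cast this
  have hn : 0 < n := hk.trans_le hkn
  have hn' : (0 : ℝ) < n := by exact_mod_cast hn
  have hkn' : (k : ℝ) ≤ n := by exact_mod_cast hkn
  have hen : 4 ≤ e * n := by
    rw [div_le_iff₀ he0] at hke
    nlinarith
  obtain ⟨r, hr⟩ : ∃ r, r = C * n / k + 1 := ⟨_, rfl⟩
  have hr0 : 0 < r := hr ▸ Nat.succ_pos _
  have hr1 : C * n ≤ k * r := hr ▸ (Nat.lt_mul_div_succ (C * n) hk).le
  have hr2 : (r : ℝ) * k ≤ (C + 1) * n := by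
    have h : r * k ≤ C * n + k := by
      rw [hr, add_mul, one_mul]
      exact Nat.add_le_add_right (Nat.div_mul_le_self _ _) _
    have h' : (r : ℝ) * k ≤ C * n + k := by exact_mod_cast h
    linarith
  -- The cover threshold is `v = (1 - e / 2) * n`, which exceeds `m` by at least `e * n / 2`.
  have hbound := R.successProb_pow_le hn hkn (mul_nonneg hq0 hn'.le) r
  rw [mul_div_cancel_right₀ _ hn'.ne'] at hbound
  have hfirst : (2 : ℝ) ^ n * (1 - e / 2) ^ (k * r) ≤ 2 ^ (-(e * n / 2)) := by
    calc (2 : ℝ) ^ n * (1 - e / 2) ^ (k * r) ≤ 2 ^ n * (1 - e / 2) ^ (C * n) := by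
          gcongr ?_ * ?_
          exact pow_le_pow_of_le_one hq0 (by linarith) hr1
      _ ≤ 2 ^ n * (1 / 4) ^ n := by
          rw [pow_mul]
          gcongr
      _ = (2 : ℝ) ^ (-(n : ℝ)) := by
          rw [← mul_pow, Real.rpow_neg two_pos.le, Real.rpow_natCast, ← inv_pow]
          norm_num
      _ ≤ _ := Real.rpow_le_rpow_of_exponent_le one_le_two (by nlinarith)
  have hsecond : (2 : ℝ) ^ ((m : ℝ) - (1 - e / 2) * n) ≤ 2 ^ (-(e * n / 2)) :=
    Real.rpow_le_rpow_of_exponent_le one_le_two (by nlinarith)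
  have hupper : R.successProb ^ (2 * r) ≤ (2 : ℝ) ^ (-(e * n / 4)) := by
    calc R.successProb ^ (2 * r) ≤ 2 ^ (1 : ℝ) * (2 : ℝ) ^ (-(e * n / 2)) := by
          rw [Real.rpow_one]
          linarith
      _ = (2 : ℝ) ^ (1 + -(e * n / 2)) := (Real.rpow_add two_pos _ _).symm
      _ ≤ _ := Real.rpow_le_rpow_of_exponent_le one_le_two (by linarith)
  -- Comparing `2r`-th powers avoids taking a root of `R.successProb`, whose sign is then
  -- irrelevant.
  by_contra! hlt
  have hlower := pow_lt_pow_left₀ hlt (by positivity) (show 2 * r ≠ 0 by positivity)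
  rw [← Real.rpow_mul_natCast two_pos.le] at hlower
  refine absurd (hlower.trans_le hupper) (not_lt.mpr ?_)
  refine Real.rpow_le_rpow_of_exponent_le one_le_two ?_
  have h : e / (8 * (C + 1)) * k * ((2 * r : ℕ) : ℝ) ≤ e * n / 4 := by
    calc e / (8 * (C + 1)) * k * ((2 * r : ℕ) : ℝ) = e / (4 * (C + 1)) * (r * k) := by
          push_cast
          field_simp
          ring
      _ ≤ e / (4 * (C + 1)) * ((C + 1) * n) := by gcongr
      _ = e * n / 4 := by field_simp
  linarith
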